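/- Consider online edge colouring with advice. The input is a sequence $\langle e_1,\dots,e_m\rangle$ of the $m$ distinct edges of a finite simple graph $G$, revealed one by one and specified by their endpoints; each edge must irrevocably be given a colour from $\{1,2,\dots\}$ upon arrival, so that edges sharing an endpoint get different colours. A colouring is optimal if it is proper and uses only colours from $\{1,\dots,\chi'(G)\}$, where $\chi'(G)$ is the chromatic index. Let $d$ be the degeneracy of $G$, i.e. the least integer such that the vertices of $G$ can be ordered so that each vertex is adjacent to at most $d$ earlier ones. The advice is prepared by an oracle that knows the whole input. There is an absolute constant $C$ such that the following hold. (1) Advice-with-request model. There are a single deterministic online algorithm and a function $b:\mathbb{N}\to\mathbb{N}$ such that, for every input, the oracle can supply a string of exactly $b(d)$ advice bits along with each edge so that the algorithm, which colours $e_i$ knowing only $e_1,\dots,e_i$ and the first $i$ advice strings, produces an optimal colouring; the total number of advice bits is $m\,b(d)\le C\,m\log_2(d+1)$. (2) Advice-on-tape model. There is a single deterministic online algorithm such that, for every input, the oracle can prepare an infinite tape of bits so that the algorithm, which colours $e_i$ knowing only $e_1,\dots,e_i$ and the bits it has so far read sequentially from the tape (it decides itself when to read another bit), produces an optimal colouring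 and reads at most $C\,m\log_2(d+1)$ bits in total. In neither model is the algorithm given $d$, an upper bound on $d$, or $m$ in advance. -/

import Mathlib

namespace OnlineEdgeColoring

universe u

/-- An input for online edge coloring: the edges of a finite simple graph in order of arrival.
Edges are unordered pairs of vertices, without loops and without repetitions; `V` is the universe
of possible vertex names, and the input does not announce the vertices in advance. -/
structure EdgeSeq (V : Type u) where
  edges : List (Sym2 V)
  nodup : edges.Nodup
  loopless : ∀ e ∈ edges, ¬ e.IsDiag

/-- The number `m` of edges of the input. -/
def EdgeSeq.size {V : Type u} (σ : EdgeSeq V) : ℕ := σ.edges.length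

/-- The input graph. Its vertices are the endpoints of the edges, i.e. its `support`. -/
def EdgeSeq.graph {V : Type u} (σ : EdgeSeq V) : SimpleGraph V :=
  SimpleGraph.fromEdgeSet {e | e ∈ σ.edges}

/-- `G` is `d`-degenerate: there is an ordering `vs` of the vertices of the finite graph `G` in
which every vertex is adjacent to at most `d` of the vertices before it. (Vertex names that are
not an endpoint of an edge are not vertices of the input graph.) -/
def IsDegenerate {V : Type u} (G : SimpleGraph V) (d : ℕ) : Prop :=
  ∃ vs : List V, vs.Nodup ∧ (∀ v, v ∈ vs ↔ v ∈ G.support) ∧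
    ∀ (i : ℕ) (hi : i < vs.length), {u | u ∈ vs.take i ∧ G.Adj vs[i] u}.ncard ≤ d

/-- The degeneracy of a finite graph: the least `d` such that it is `d`-degenerate. -/
noncomputable def degeneracy {V : Type u} (G : SimpleGraph V) : ℕ :=
  sInf {d | IsDegenerate G d}

/-- The chromatic index of `G`: the least number of colors in an edge coloring of `G`, i.e. in a
vertex coloring of its line graph. -/
noncomputable def chromaticIndex {V : Type u} (G : SimpleGraph V) : ℕ∞ :=
  G.lineGraph.chromaticNumber

/-- `c` (the color of the `i`-th edge being `c i`, counting from `0`) is an optimal edge coloring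
of the input: it is proper, and all its colors are among `1, …, χ'`. -/
def IsOptimalColoring {V : Type u} (σ : EdgeSeq V) (c : ℕ → ℕ) : Prop :=
  (∀ i < σ.size, 1 ≤ c i ∧ (c i : ℕ∞) ≤ chromaticIndex σ.graph) ∧
  ∀ (i j : ℕ) (hi : i < σ.edges.length) (hj : j < σ.edges.length), i ≠ j →
    (∃ v, v ∈ σ.edges[i] ∧ v ∈ σ.edges[j]) → c i ≠ c j

/-! ### Advice with request -/

/-- A deterministic online algorithm with advice given along with each request. From the edges
revealed so far and the advice strings received so far (both including the current one) it decides
the color of the last revealed edge. -/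
def RequestAlg (V : Type u) : Type u := List (Sym2 V) → List (List Bool) → ℕ

/-- The color that `A` gives to the `i`-th edge (counting from `0`) of the input when the
sequence of advice strings is `B`. -/
def RequestAlg.color {V : Type u} (A : RequestAlg V) (σ : EdgeSeq V) (B : List (List Bool))
    (i : ℕ) : ℕ :=
  A (σ.edges.take (i + 1)) (B.take (i + 1))

/-- `B` is advice for the input that consists of exactly `b` bits per edge. -/
def IsRequestAdvice {V : Type u} (σ : EdgeSeq V) (b : ℕ) (B : List (List Bool)) : Prop :=
  B.length = σ.size ∧ ∀ s ∈ B, s.length = b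

/-! ### Advice on tape -/

/-- A deterministic online algorithm with an advice tape, which is read from left to right. From
the edges revealed so far (including the current one) and the advice bits read so far it decides
its next action: `none` is to read one more bit of the tape, `some c` is to give color `c` to the
last revealed edge. -/
def TapeAlg (V : Type u) : Type u := List (Sym2 V) → List Bool → Option ℕ

/-- The first `q` bits of the tape. -/
def tapePrefix (tape : ℕ → Bool) (q : ℕ) : List Bool := (List.range q).map tape

/-- The run of `A` on the input `σ` with the given infinite advice tape: `c i` is the color of the
`i`-th edge (counting from `0`), and `r i` is the total number of bits that have been read
when the first `i` edges have been colored. -/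
def TapeAlg.IsRun {V : Type u} (A : TapeAlg V) (σ : EdgeSeq V) (tape : ℕ → Bool)
    (r c : ℕ → ℕ) : Prop :=
  r 0 = 0 ∧ ∀ i < σ.size, r i ≤ r (i + 1) ∧
    (∀ q, r i ≤ q → q < r (i + 1) → A (σ.edges.take (i + 1)) (tapePrefix tape q) = none) ∧
    A (σ.edges.take (i + 1)) (tapePrefix tape (r (i + 1))) = some (c i)

end OnlineEdgeColoring

/-! Orient every edge from its endpoint that is earlier in a degeneracy order (the tail) to the
later one (the head): at most d edges enter a vertex, while any number may leave it. Let s be the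
power of two with 2d < s ≤ 4d. The advice for an edge names its tail and gives one mark and an
offset below 2s, which is O(log(d+1)) bits.

If all degrees are at most 2s, offsets alone spell out an optimal coloring. Otherwise Δ colors
suffice; they are cut into palettes of s consecutive colors, the remainder going to the last one.
The edges out of v are cut, in order of arrival, into runs that use palettes 0, 1, 2, …, and a mark
shows where a run begins, so that counting the marks at the tail yields the palette. A run ends
exactly when v has s edges in its palette, entering edges included (`exists_isBlockAssignment`).
Hence each palette has to color a d-degenerate graph whose maximum degree is at most the number of
its colors, and this number is at least 2d. Such a graph can be colored by Kempe chains
(`IsDegenerateRank.exists_isProperOn`).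

The algorithm infers s from the length of the advice strings. On a tape this length comes first, in
unary. -/

namespace OnlineEdgeColoring

open Finset

/-! ### Proper edge colorings and Kempe chains -/

section ProperColoring

variable {V : Type*}

/-- The number of edges of `E` at `v`. -/
noncomputable def edgeDegree (E : Finset (Sym2 V)) (v : V) : ℕ :=
  by classical exact #{e ∈ E | v ∈ e}

/-- `c` gives different colors to different edges of `E` that share an endpoint. -/
def IsProperOn (E : Finset (Sym2 V)) (c : Sym2 V → ℕ) : Prop :=
  ∀ e ∈ E, ∀ f ∈ E, e ≠ f → ∀ v, v ∈ e → v ∈ f → c e ≠ c f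

/-- No edge of `E` at `v` has color `a`. -/
def IsMissing (E : Finset (Sym2 V)) (c : Sym2 V → ℕ) (v : V) (a : ℕ) : Prop :=
  ∀ e ∈ E, v ∈ e → c e ≠ a

/-- The subgraph of the edges of `E` with color `a` or `b`. -/
def kempeGraph (E : Finset (Sym2 V)) (c : Sym2 V → ℕ) (a b : ℕ) : SimpleGraph V :=
  SimpleGraph.fromEdgeSet {e | e ∈ E ∧ (c e = a ∨ c e = b)}

lemma edgeDegree_mono {E F : Finset (Sym2 V)} (h : E ⊆ F) (v : V) :
    edgeDegree E v ≤ edgeDegree F v := by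
  classical
  exact card_le_card (filter_subset_filter _ h)

open scoped Classical in
lemma edgeDegree_insert {E : Finset (Sym2 V)} {e : Sym2 V} (he : e ∉ E) {v : V} (hv : v ∈ e) :
    edgeDegree (insert e E) v = edgeDegree E v + 1 := by
  unfold edgeDegree
  rw [filter_insert, if_pos hv, card_insert_of_notMem (by simp [he])]

open scoped Classical in
lemma le_card_missing (E : Finset (Sym2 V)) (c : Sym2 V → ℕ) (n : ℕ) (v : V) :
    n ≤ #{a ∈ range n | IsMissing E c v a} + edgeDegree E v := by
  have h : range n ⊆ {a ∈ range n | IsMissing E c v a} ∪ ({e ∈ E | v ∈ e}).image c := by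
    intro a ha
    by_cases hm : IsMissing E c v a
    · simp [hm, mem_range.1 ha]
    · simp only [IsMissing, not_forall, not_not] at hm
      obtain ⟨e, he, hv, hc⟩ := hm
      exact mem_union_right _ (mem_image.2 ⟨e, by simp [he, hv], hc⟩)
  calc n = #(range n) := (card_range n).symm
    _ ≤ _ := card_le_card h
    _ ≤ _ := card_union_le _ _
    _ ≤ _ := by unfold edgeDegree; gcongr; exact card_image_le

lemma eq_mk_of_mem {e : Sym2 V} {u v : V} (hu : u ∈ e) (hv : v ∈ e) (h : u ≠ v) :
    e = s(u, v) := ((Sym2.mem_and_mem_iff h).1 ⟨hu, hv⟩)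

lemma kempeGraph_adj_of_mem {E : Finset (Sym2 V)} {c : Sym2 V → ℕ} {a b : ℕ} {e : Sym2 V}
    (he : e ∈ E) (hc : c e = a ∨ c e = b) {u v : V} (hu : u ∈ e) (hv : v ∈ e) (h : u ≠ v) :
    (kempeGraph E c a b).Adj u v := by
  have := eq_mk_of_mem hu hv h
  subst this
  simp [kempeGraph, he, hc, h]

/-- Exchanging the colors `a` and `b` on the Kempe component of `x`. -/
lemma exists_kempe_swap {E : Finset (Sym2 V)} {c : Sym2 V → ℕ} {n a b : ℕ} {x : V}
    (hc : IsProperOn E c) (hn : ∀ e ∈ E, c e < n) (ha : a < n) (hb : b < n)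
    (hx : IsMissing E c x a) :
    ∃ c' : Sym2 V → ℕ, IsProperOn E c' ∧ (∀ e ∈ E, c' e < n) ∧ IsMissing E c' x b ∧
      (∀ y, ¬ (kempeGraph E c a b).Reachable x y → IsMissing E c y b → IsMissing E c' y b) ∧
      ∀ e ∈ E, ∀ k, k ≠ a → k ≠ b → (c' e = k ↔ c e = k) := by
  classical
  set R : Set V := {v | (kempeGraph E c a b).Reachable x v}
  have hR : ∀ e ∈ E, ∀ u ∈ e, ∀ v ∈ e, u ∈ R → v ∉ R → c e ≠ a ∧ c e ≠ b := by
    intro e he u hu v hv huR hvR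
    rw [← not_or]
    intro hab
    have huv : u ≠ v := fun h => hvR (h ▸ huR)
    exact hvR (SimpleGraph.Reachable.trans huR
      (kempeGraph_adj_of_mem he hab hu hv huv).reachable)
  -- By `hR` an edge that leaves `R` has neither color, so the swap fixes its color. Seen from a
  -- vertex of `R` all edges are swapped, and seen from any other vertex none is changed.
  let c' : Sym2 V → ℕ := fun e => if ∃ v ∈ e, v ∈ R then Equiv.swap a b (c e) else c e
  have hout : ∀ e ∈ E, ∀ v ∈ e, v ∉ R → c' e = c e := by
    intro e he v hv hvR
    by_cases h : ∃ u ∈ e, u ∈ R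
    · obtain ⟨u, hu, huR⟩ := id h
      obtain ⟨h1, h2⟩ := hR e he u hu v hv huR hvR
      simp only [c', if_pos h]
      exact Equiv.swap_apply_of_ne_of_ne h1 h2
    · simp only [c', if_neg h]
  have hin : ∀ e, ∀ v ∈ e, v ∈ R → c' e = Equiv.swap a b (c e) := by
    intro e v hv hvR
    simp only [c', if_pos (⟨v, hv, hvR⟩ : ∃ v ∈ e, v ∈ R)]
  refine ⟨c', ?_, ?_, ?_, ?_, ?_⟩
  · intro e he f hf hef v hve hvf
    by_cases hv : v ∈ R
    · rw [hin e v hve hv, hin f v hvf hv]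
      exact fun h => hc e he f hf hef v hve hvf ((Equiv.swap a b).injective h)
    · rw [hout e he v hve hv, hout f hf v hvf hv]
      exact hc e he f hf hef v hve hvf
  · intro e he
    have := hn e he
    simp only [c']
    split_ifs
    · rw [Equiv.swap_apply_def]; split_ifs <;> assumption
    · exact this
  · intro e he hxe
    rw [hin e x hxe (SimpleGraph.Reachable.refl x)]
    intro h
    rw [Equiv.swap_apply_eq_iff, Equiv.swap_apply_right] at h
    exact hx e he hxe h
  · intro y hy hm e he hye
    rw [hout e he y hye hy]
    exact hm e he hye
  · intro e he k hka hkb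
    simp only [c']
    split_ifs
    · rw [Equiv.swap_apply_eq_iff, Equiv.swap_apply_of_ne_of_ne hka hkb]
    · rfl

open scoped Classical in
-- Properness makes the colors of the edges from `v` to `t` distinct, and only colors in `A` can
-- occur. This gives degree at most 2 in a Kempe chain, and at most 1 where one of the two colors is
-- missing.
lemma card_le_of_kempe {E : Finset (Sym2 V)} {c : Sym2 V → ℕ} {a b : ℕ}
    (hc : IsProperOn E c) {v : V} {t : Finset V}
    (ht : ∀ u ∈ t, (kempeGraph E c a b).Adj v u) (A : Finset ℕ)
    (hm : ∀ k ∈ ({a, b} : Finset ℕ) \ A, IsMissing E c v k) : #t ≤ #A := by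
  refine card_le_card_of_injOn (fun u => c s(v, u)) ?_ ?_
  · intro u hu
    have h := ht u hu
    simp only [kempeGraph, SimpleGraph.fromEdgeSet_adj, Set.mem_ofPred_eq] at h
    by_contra hcon
    refine hm (c s(v, u)) ?_ s(v, u) h.1.1 (by simp) rfl
    simp only [mem_sdiff, mem_insert, mem_singleton]
    exact ⟨h.1.2, hcon⟩
  · intro u hu w hw h
    have hu := ht u hu
    have hw := ht w hw
    simp only [kempeGraph, SimpleGraph.fromEdgeSet_adj, Set.mem_ofPred_eq] at hu hw
    by_contra hne
    exact hc _ hu.1.1 _ hw.1.1 (by rw [Ne, Sym2.congr_right]; exact hne) v (by simp) (by simp) h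

/-- A Kempe chain has at most two end points. -/
lemma not_reachable_of_isMissing {E : Finset (Sym2 V)} {c : Sym2 V → ℕ} {a b : ℕ} {x y z : V}
    (hc : IsProperOn E c) (hxy : x ≠ y) (hxz : x ≠ z) (hyz : y ≠ z)
    (hx : IsMissing E c x a) (hy : IsMissing E c y b) (hz : IsMissing E c z b)
    (hxy' : (kempeGraph E c a b).Reachable x y) :
    ¬ (kempeGraph E c a b).Reachable x z := by
  classical
  intro hxz'
  set G := kempeGraph E c a b
  set C := G.connectedComponentMk x
  have hfin : C.supp.Finite := by
    have h1 : {v | ∃ e ∈ E, v ∈ e}.Finite := by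
      have : {v | ∃ e ∈ E, v ∈ e} = ⋃ e ∈ E, {v | v ∈ e} := by ext; simp
      rw [this]
      refine Set.Finite.biUnion E.finite_toSet fun e _ => ?_
      induction e with
      | _ p q => exact (Set.toFinite {p, q}).subset fun v hv => by simpa using hv
    refine (h1.insert x).subset fun v hv => ?_
    rw [SimpleGraph.ConnectedComponent.mem_supp_iff, SimpleGraph.ConnectedComponent.eq] at hv
    by_cases hvx : v = x
    · exact Or.inl hvx
    · obtain ⟨w⟩ := hv
      cases w with
      | nil => exact absurd rfl hvx
      | cons h p =>
        simp only [G, kempeGraph, SimpleGraph.fromEdgeSet_adj, Set.mem_ofPred_eq] at h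
        exact Or.inr ⟨_, h.1.1, by simp⟩
  have : Fintype C.supp := hfin.fintype
  have hconn : C.toSimpleGraph.Connected := C.connected_toSimpleGraph
  -- A connected graph on k vertices has degree sum at least 2k - 2. Here all degrees are at most 2,
  -- and those of `x`, `y` and `z` at most 1, so the sum would be at most 2k - 3.
  have h1 := hconn.card_vert_le_card_edgeSet_add_one
  have h2 : ∑ v, C.toSimpleGraph.degree v = 2 * Nat.card C.toSimpleGraph.edgeSet := by
    rw [Nat.card_eq_fintype_card, ← SimpleGraph.edgeFinset_card,
      ← SimpleGraph.sum_degrees_eq_twice_card_edges]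
  have hxC : x ∈ C.supp := by simp [C]
  have hyC : y ∈ C.supp := by
    rw [SimpleGraph.ConnectedComponent.mem_supp_iff, SimpleGraph.ConnectedComponent.eq]
    exact hxy'.symm
  have hzC : z ∈ C.supp := by
    rw [SimpleGraph.ConnectedComponent.mem_supp_iff, SimpleGraph.ConnectedComponent.eq]
    exact hxz'.symm
  have hdeg : ∀ v : C.supp, ∀ A : Finset ℕ,
      (∀ k ∈ ({a, b} : Finset ℕ) \ A, IsMissing E c v k) → C.toSimpleGraph.degree v ≤ #A := by
    intro v A hm
    rw [← SimpleGraph.card_neighborFinset_eq_degree,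
      ← card_map (Function.Embedding.subtype (· ∈ C.supp))]
    refine card_le_of_kempe hc (v := v) (fun u hu => ?_) A hm
    simp only [mem_map, SimpleGraph.mem_neighborFinset, Function.Embedding.subtype_apply] at hu
    obtain ⟨w, hw, rfl⟩ := hu
    exact hw
  have hend : ∀ v : C.supp, C.toSimpleGraph.degree v +
      (if v ∈ ({⟨x, hxC⟩, ⟨y, hyC⟩, ⟨z, hzC⟩} : Finset C.supp) then 1 else 0) ≤ 2 := by
    intro v
    split_ifs with h
    · simp only [mem_insert, mem_singleton] at h
      rcases h with rfl | rfl | rfl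
      · have := hdeg ⟨x, hxC⟩ {b} (by
          intro k hk; simp at hk; obtain ⟨h1 | h1, h2⟩ := hk
          · exact h1 ▸ hx
          · exact absurd h1 h2)
        simp at this; omega
      · have := hdeg ⟨y, hyC⟩ {a} (by
          intro k hk; simp at hk; obtain ⟨h1 | h1, h2⟩ := hk
          · exact absurd h1 h2
          · exact h1 ▸ hy)
        simp at this; omega
      · have := hdeg ⟨z, hzC⟩ {a} (by
          intro k hk; simp at hk; obtain ⟨h1 | h1, h2⟩ := hk
          · exact absurd h1 h2
          · exact h1 ▸ hz)
        simp at this; omega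
    · exact (hdeg v {a, b} (by simp)).trans (card_le_two)
  have h3 := sum_le_sum fun v (_ : v ∈ (univ : Finset C.supp)) => hend v
  rw [sum_add_distrib, sum_ite_mem, univ_inter] at h3
  have h4 : #({⟨x, hxC⟩, ⟨y, hyC⟩, ⟨z, hzC⟩} : Finset C.supp) = 3 := by
    rw [card_eq_three]
    exact ⟨_, _, _, by simpa using hxy, by simpa using hxz, by simpa using hyz, rfl⟩
  simp only [sum_const, card_univ, smul_eq_mul, h4, mul_one] at h3
  have h5 : ∑ v, C.toSimpleGraph.degree v + 3 ≤ Fintype.card C.supp * 2 :=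
    le_of_eq_of_le (by congr!) h3
  rw [show Nat.card C = Fintype.card C.supp from Nat.card_eq_fintype_card] at h1
  omega

end ProperColoring

/-! ### Edge coloring of degenerate graphs -/

section Vizing

variable {V : Type*}

/-- Every edge of `E` joins vertices of different rank, and every vertex is joined by at most
`d` edges of `E` to vertices of smaller rank. -/
structure IsDegenerateRank (E : Finset (Sym2 V)) (rank : V → ℕ) (d : ℕ) : Prop where
  ne : ∀ u v, s(u, v) ∈ E → rank u ≠ rank v
  card_le : ∀ v, ∀ t : Finset V, (∀ u ∈ t, s(v, u) ∈ E ∧ rank u < rank v) → #t ≤ d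

lemma IsDegenerateRank.mono {E F : Finset (Sym2 V)} {rank : V → ℕ} {d : ℕ}
    (h : IsDegenerateRank F rank d) (hEF : E ⊆ F) : IsDegenerateRank E rank d :=
  ⟨fun u v huv => h.ne u v (hEF huv),
    fun v t ht => h.card_le v t fun u hu => ⟨hEF (ht u hu).1, (ht u hu).2⟩⟩

/-- There is an edge `xy` such that `y` and all but `d` neighbors of `x` have degree at
most `d`. -/
lemma IsDegenerateRank.exists_edge {E : Finset (Sym2 V)} {rank : V → ℕ} {d : ℕ}
    (h : IsDegenerateRank E rank d) (hE : E.Nonempty) :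
    ∃ x y, s(x, y) ∈ E ∧ edgeDegree E y ≤ d ∧
      ∀ t : Finset V, (∀ u ∈ t, s(x, u) ∈ E ∧ d < edgeDegree E u) → #t ≤ d := by
  classical
  by_cases hbig : ∃ e ∈ E, ∃ v ∈ e, d < edgeDegree E v
  · let S : Set ℕ := {r | ∃ e ∈ E, ∃ v ∈ e, d < edgeDegree E v ∧ rank v = r}
    have hfin : S.Finite := by
      have : S ⊆ ⋃ e ∈ E, rank '' {v | v ∈ e} := by
        rintro r ⟨e, he, v, hv, -, rfl⟩
        simp only [Set.mem_iUnion]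
        exact ⟨e, he, v, hv, rfl⟩
      refine Set.Finite.subset (Set.Finite.biUnion E.finite_toSet fun e _ => ?_) this
      refine Set.Finite.image _ ?_
      induction e with
      | _ p q => exact (Set.toFinite {p, q}).subset fun v hv => by simpa using hv
    have hne : S.Nonempty := by
      obtain ⟨e, he, v, hv, hd⟩ := hbig
      exact ⟨rank v, e, he, v, hv, hd, rfl⟩
    obtain ⟨r, ⟨e, he, x, hx, hxd, hxr⟩, hmax⟩ := Set.exists_max_image S id hfin hne
    have hsmall : ∀ t : Finset V, (∀ u ∈ t, s(x, u) ∈ E ∧ d < edgeDegree E u) → #t ≤ d := by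
      intro t ht
      refine h.card_le x t fun u hu => ⟨(ht u hu).1, ?_⟩
      have h1 := hmax (rank u) ⟨_, (ht u hu).1, u, by simp, (ht u hu).2, rfl⟩
      have h2 := h.ne x u (ht u hu).1
      simp only [id] at h1
      omega
    obtain ⟨y, hy, hyd⟩ : ∃ y, s(x, y) ∈ E ∧ edgeDegree E y ≤ d := by
      by_contra! hcon
      have hmem : ∀ e : {e // e ∈ ({e ∈ E | x ∈ e} : Finset (Sym2 V))}, e.1 ∈ E ∧ x ∈ e.1 := by
        rintro ⟨e, he⟩
        exact mem_filter.1 he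
      let t : Finset V := ({e ∈ E | x ∈ e} : Finset _).attach.image
        fun e => Sym2.Mem.other (hmem e).2
      have ht : ∀ u ∈ t, s(x, u) ∈ E := by
        intro u hu
        obtain ⟨e, -, rfl⟩ := mem_image.1 hu
        rw [Sym2.other_spec]
        exact (hmem e).1
      have h1 := hsmall t fun u hu => ⟨ht u hu, hcon u (ht u hu)⟩
      rw [card_image_of_injective, card_attach] at h1
      · unfold edgeDegree at hxd
        omega
      · intro e f hef
        have := congrArg (fun w => s(x, w)) hef
        simp only [Sym2.other_spec] at this
        exact Subtype.ext this
    exact ⟨x, y, hy, hyd, hsmall⟩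
  · push Not at hbig
    obtain ⟨e, he⟩ := hE
    induction e with
    | _ x y =>
      refine ⟨x, y, he, hbig _ he y (by simp), fun t ht => ?_⟩
      have : t = ∅ := eq_empty_of_forall_notMem fun u hu =>
        absurd (hbig _ (ht u hu).1 u (by simp)) (not_le.2 (ht u hu).2)
      simp [this]

open scoped Classical in
lemma IsProperOn.insert_update {E : Finset (Sym2 V)} {c : Sym2 V → ℕ} (hc : IsProperOn E c)
    {x y : V} {a : ℕ} (hx : IsMissing E c x a) (hy : IsMissing E c y a) (he : s(x, y) ∉ E) :
    IsProperOn (insert s(x, y) E) (Function.update c s(x, y) a) := by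
  have key : ∀ f ∈ E, ∀ v, v ∈ s(x, y) → v ∈ f → c f ≠ a := by
    intro f hf v hv hvf
    rcases Sym2.mem_iff.1 hv with rfl | rfl
    · exact hx f hf hvf
    · exact hy f hf hvf
  intro e he' f hf' hef v hve hvf
  have hne : ∀ g ∈ E, g ≠ s(x, y) := fun g hg h => he (h ▸ hg)
  rcases mem_insert.1 he' with rfl | he1 <;> rcases mem_insert.1 hf' with rfl | hf1
  · exact absurd rfl hef
  · rw [Function.update_self, Function.update_of_ne (hne f hf1)]
    exact (key f hf1 v hve hvf).symm
  · rw [Function.update_self, Function.update_of_ne (hne e he1)]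
    exact key e he1 v hvf hve
  · rw [Function.update_of_ne (hne e he1), Function.update_of_ne (hne f hf1)]
    exact hc e he1 f hf1 hef v hve hvf

/-- The case of Vizing's theorem where the maximum degree is at least twice the degeneracy. -/
theorem IsDegenerateRank.exists_isProperOn {rank : V → ℕ} {d n : ℕ} (hdn : 2 * d ≤ n)
    (E : Finset (Sym2 V)) (h : IsDegenerateRank E rank d) (hn : ∀ v, edgeDegree E v ≤ n) :
    ∃ c : Sym2 V → ℕ, IsProperOn E c ∧ ∀ e ∈ E, c e < n := by
  classical
  induction hk : #E generalizing E with
  | zero =>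
    rw [card_eq_zero] at hk
    subst hk
    exact ⟨fun _ => 0, by simp [IsProperOn], by simp⟩
  | succ k ih =>
  obtain ⟨x, y, hxyE, hyd, hbig⟩ := h.exists_edge (card_pos.1 (by omega))
  have hxy : x ≠ y := by
    rintro rfl
    exact h.ne x x hxyE rfl
  set F := E.erase s(x, y)
  have hFE : F ⊆ E := erase_subset _ _
  have hEF : insert s(x, y) F = E := insert_erase hxyE
  have hxyF : s(x, y) ∉ F := by simp [F]
  obtain ⟨c, hc, hcn⟩ := ih F (h.mono hFE) (fun v => (edgeDegree_mono hFE v).trans (hn v))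
    (by rw [card_erase_of_mem hxyE]; omega)
  have hdx := edgeDegree_insert hxyF (v := x) (by simp)
  have hdy := edgeDegree_insert hxyF (v := y) (by simp)
  rw [hEF] at hdx hdy
  have hupd : ∀ (c : Sym2 V → ℕ) (a : ℕ), IsProperOn F c → (∀ e ∈ F, c e < n) → a < n →
      IsMissing F c x a → IsMissing F c y a →
      ∃ c : Sym2 V → ℕ, IsProperOn E c ∧ ∀ e ∈ E, c e < n := by
    intro c a hc hcn ha hax hay
    refine ⟨Function.update c s(x, y) a, ?_, ?_⟩
    · rw [← hEF]
      exact hc.insert_update hax hay hxyF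
    · intro e he
      by_cases hexy : e = s(x, y)
      · simpa [hexy] using ha
      · rw [Function.update_of_ne hexy]
        exact hcn e (mem_erase.2 ⟨hexy, he⟩)
  by_cases hcommon : ∃ a < n, IsMissing F c x a ∧ IsMissing F c y a
  · obtain ⟨a, ha, hax, hay⟩ := hcommon
    exact hupd c a hc hcn ha hax hay
  push Not at hcommon
  -- a neighbor `z` of `x` along a color missing at `y`
  obtain ⟨z, g, hxzF, hzd, hgy, hg⟩ : ∃ z g, s(x, z) ∈ F ∧ edgeDegree E z ≤ d ∧
      IsMissing F c y g ∧ c s(x, z) = g := by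
    -- Without `xy`, the vertex `y` has degree less than `d`, so more than `n - d ≥ d` colors are
    -- missing at `y`. Each of them occurs at `x`, as no color is missing at both, and at most `d`
    -- of the neighbors reached in this way have degree more than `d`.
    by_contra! hcon
    have h1 : ∀ g ∈ ({g ∈ range n | IsMissing F c y g} : Finset ℕ),
        ∃ z, s(x, z) ∈ F ∧ c s(x, z) = g := by
      intro g hg
      rw [mem_filter, mem_range] at hg
      have := hcommon g hg.1
      by_contra! hcon
      refine this (fun e he hxe hce => ?_) hg.2
      refine hcon (Sym2.Mem.other hxe) ?_ ?_ <;> rwa [Sym2.other_spec]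
    have : Nonempty V := ⟨x⟩
    choose! z hz using h1
    have h2 := hbig (({g ∈ range n | IsMissing F c y g} : Finset ℕ).image z) (by
      intro u hu
      obtain ⟨g, hg, rfl⟩ := mem_image.1 hu
      refine ⟨hFE (hz g hg).1, ?_⟩
      by_contra! hle
      exact hcon (z g) g (hz g hg).1 hle (mem_filter.1 hg).2 (hz g hg).2)
    rw [card_image_of_injOn] at h2
    · have := le_card_missing F c n y
      omega
    · intro g hg g' hg' hgg
      rw [← (hz g hg).2, ← (hz g' hg').2]
      rw [hgg]
  have hxz : x ≠ z := by
    rintro rfl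
    exact h.ne x x (hFE hxzF) rfl
  have hyz : y ≠ z := by
    rintro rfl
    exact hxyF hxzF
  -- At least `n - d + 1` colors are missing at `y` and `n - d` at `z`. Together these are more than
  -- `n`, because `2 * d ≤ n`.
  obtain ⟨b, hb, hby, hbz⟩ : ∃ b < n, IsMissing F c y b ∧ IsMissing F c z b := by
    have h1 := le_card_missing F c n y
    have h2 := le_card_missing F c n z
    have h3 := edgeDegree_mono hFE z
    have h4 := card_union_add_card_inter ({a ∈ range n | IsMissing F c y a} : Finset ℕ)
      {a ∈ range n | IsMissing F c z a}
    have h5 : #(({a ∈ range n | IsMissing F c y a} : Finset ℕ) ∪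
      {a ∈ range n | IsMissing F c z a}) ≤ #(range n) :=
      card_le_card (union_subset (filter_subset _ _) (filter_subset _ _))
    rw [card_range] at h5
    obtain ⟨b, hb⟩ := card_pos.1 (show 0 < #(({a ∈ range n | IsMissing F c y a} : Finset ℕ) ∩
      {a ∈ range n | IsMissing F c z a}) by omega)
    simp only [mem_inter, mem_filter, mem_range] at hb
    exact ⟨b, hb.1.1, hb.1.2, hb.2.2⟩
  obtain ⟨a, ha, hax⟩ : ∃ a < n, IsMissing F c x a := by
    have h1 := le_card_missing F c n x
    have h2 := hn x
    obtain ⟨a, ha⟩ := card_pos.1 (show 0 < #{a ∈ range n | IsMissing F c x a} by omega)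
    simp only [mem_filter, mem_range] at ha
    exact ⟨a, ha.1, ha.2⟩
  obtain ⟨c', hc', hcn', hbx', hkeep, hother⟩ := exists_kempe_swap hc hcn ha hb hax
  -- If the chain of `x` contains `y`, it avoids `z`. After the swap `b` is missing at `x` and `z`,
  -- so `xz` takes `b` and leaves its old color `g` to `xy`. If the chain avoids `y`, then `xy`
  -- takes `b`.
  by_cases hreach : (kempeGraph F c a b).Reachable x y
  · have hbz' := hkeep z (not_reachable_of_isMissing hc hxy hxz hyz hax hby hbz hreach) hbz
    have hga : g ≠ a := fun h => hax _ hxzF (by simp) (hg.trans h)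
    have hgb : g ≠ b := fun h => hbz _ hxzF (by simp) (hg.trans h)
    set F' := F.erase s(x, z)
    have hFF : insert s(x, z) F' = F := insert_erase hxzF
    have hxzF' : s(x, z) ∉ F' := by simp [F']
    have hsub : F' ⊆ F := erase_subset _ _
    have h1 : IsProperOn F (Function.update c' s(x, z) b) := by
      have h0 : IsProperOn F' c' := fun e he f hf => hc' e (hsub he) f (hsub hf)
      have := h0.insert_update (fun e he => hbx' e (hsub he)) (fun e he => hbz' e (hsub he)) hxzF'
      rwa [hFF] at this
    refine hupd _ g h1 ?_ (hg ▸ hcn _ hxzF) ?_ ?_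
    · intro e he
      by_cases hexz : e = s(x, z)
      · simpa [hexz] using hb
      · rw [Function.update_of_ne hexz]
        exact hcn' e he
    · intro e he hxe
      by_cases hexz : e = s(x, z)
      · simpa [hexz] using hgb.symm
      · rw [Function.update_of_ne hexz, Ne, hother e he g hga hgb]
        intro h
        exact hc e he _ hxzF hexz x hxe (by simp) (h.trans hg.symm)
    · intro e he hye
      by_cases hexz : e = s(x, z)
      · simpa [hexz] using hgb.symm
      · rw [Function.update_of_ne hexz, Ne, hother e he g hga hgb]
        exact hgy e he hye
  · exact hupd c' b hc' hcn' hb hbx' (hkeep y hreach hby)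

end Vizing

/-! ### Cutting the edges out of each vertex into blocks -/

section Blocks

lemma filter_range_congr {m : ℕ} {p q : ℕ → Prop} [DecidablePred p] [DecidablePred q]
    (h : ∀ i < m, (p i ↔ q i)) :
    #{i ∈ range m | p i} = #{i ∈ range m | q i} :=
  congrArg card (filter_congr fun i hi => h i (mem_range.1 hi))

open scoped Classical in
/-- The indices `i < m` with `S i` are cut into at most `K` consecutive blocks, such that block
`k`, if it is not the last one, has `s - back k` elements. A new block begins where `inc` holds. -/
lemma exists_blocks (S : ℕ → Prop) (back : ℕ → ℕ) {s K : ℕ} (hb : ∀ k, back k < s) (hK : 0 < K)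
    (m : ℕ) :
    ∃ (blk : ℕ → ℕ) (inc : ℕ → Prop),
      (∀ i < m, S i → blk i = #{j ∈ range (i + 1) | S j ∧ inc j}) ∧
      (∀ i < m, S i → blk i ≤ #{j ∈ range m | S j ∧ inc j}) ∧
      #{j ∈ range m | S j ∧ inc j} < K ∧
      (∀ k < #{j ∈ range m | S j ∧ inc j}, #{i ∈ range m | S i ∧ blk i = k} + back k = s) ∧
      ∀ k, k + 1 < K → #{i ∈ range m | S i ∧ blk i = k} + back k ≤ s := by
  induction m with
  | zero => exact ⟨fun _ => 0, fun _ => False, by simp, by simp, by simpa using hK, by simp,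
      fun k _ => by simpa using (hb k).le⟩
  | succ m ih =>
  obtain ⟨blk, inc, hA, hB, hC, hD, hE⟩ := ih
  by_cases hS : S m
  swap
  · have h : #{j ∈ range (m + 1) | S j ∧ inc j} = #{j ∈ range m | S j ∧ inc j} := by
      rw [range_add_one, filter_insert, if_neg (fun h => hS h.1)]
    have h' : ∀ i < m + 1, S i → i < m := fun i hi hSi =>
      lt_of_le_of_ne (Nat.lt_succ_iff.1 hi) fun h => hS (h ▸ hSi)
    have hblk : ∀ k, #{j ∈ range (m + 1) | S j ∧ blk j = k} = #{j ∈ range m | S j ∧ blk j = k} := by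
      intro k
      rw [range_add_one, filter_insert, if_neg (fun h => hS h.1)]
    refine ⟨blk, inc, fun i hi hSi => hA i (h' i hi hSi) hSi, fun i hi hSi => ?_, ?_, ?_, ?_⟩
    · rw [h]
      exact hB i (h' i hi hSi) hSi
    · rwa [h]
    · simpa only [h, hblk] using hD
    · simpa only [hblk] using hE
  set cur := #{j ∈ range m | S j ∧ inc j}
  -- A block is closed only when it is full, `back` counting the places occupied in advance. The
  -- last block, `K - 1`, is never closed and absorbs all that remains.
  set new : Prop := cur + 1 < K ∧ #{i ∈ range m | S i ∧ blk i = cur} + back cur = s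
  set b : ℕ := if new then cur + 1 else cur
  have hinc : ∀ i ≤ m, #{j ∈ range i | S j ∧ Function.update inc m new j} =
      #{j ∈ range i | S j ∧ inc j} := fun i hi => filter_range_congr fun j hj => by
    rw [Function.update_of_ne (by omega)]
  have hinc' : #{j ∈ range (m + 1) | S j ∧ Function.update inc m new j} = b := by
    rw [range_add_one, filter_insert]
    by_cases hn : new
    · rw [if_pos (by simp [hS, hn]), card_insert_of_notMem (by simp), hinc m le_rfl]
      simp [b, hn, cur]
    · rw [if_neg (by simp [hn]), hinc m le_rfl]
      simp [b, hn, cur]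
  have hblk : ∀ k, #{i ∈ range (m + 1) | S i ∧ Function.update blk m b i = k} =
      #{i ∈ range m | S i ∧ blk i = k} + if b = k then 1 else 0 := by
    intro k
    have h0 : #{i ∈ range m | S i ∧ Function.update blk m b i = k} =
        #{i ∈ range m | S i ∧ blk i = k} := filter_range_congr fun j hj => by
      rw [Function.update_of_ne (by omega)]
    rw [range_add_one, filter_insert]
    by_cases hn : b = k
    · rw [if_pos (by simp [hS, hn]), card_insert_of_notMem (by simp), h0, if_pos hn]
    · rw [if_neg (by simp [hn]), h0, if_neg hn, add_zero]
  have hzero : ∀ k, cur < k → #{i ∈ range m | S i ∧ blk i = k} = 0 := by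
    intro k hk
    rw [card_eq_zero, filter_eq_empty_iff]
    rintro i hi ⟨hSi, rfl⟩
    exact absurd (hB i (mem_range.1 hi) hSi) (by omega)
  have hcb : cur ≤ b := by simp only [b]; split_ifs <;> omega
  refine ⟨Function.update blk m b, Function.update inc m new, ?_, ?_, ?_, ?_, ?_⟩
  · intro i hi hSi
    rcases Nat.lt_succ_iff_lt_or_eq.1 hi with hi | rfl
    · rw [Function.update_of_ne (by omega), hinc _ hi]
      exact hA i hi hSi
    · rw [Function.update_self, hinc']
  · intro i hi hSi
    rw [hinc']
    rcases Nat.lt_succ_iff_lt_or_eq.1 hi with hi | rfl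
    · rw [Function.update_of_ne (by omega)]
      exact (hB i hi hSi).trans hcb
    · rw [Function.update_self]
  · rw [hinc']
    by_cases hn : new
    · simpa [b, hn] using hn.1
    · simpa [b, hn] using hC
  · intro k hk
    rw [hinc'] at hk
    rw [hblk, if_neg (by omega), add_zero]
    by_cases hn : new
    · simp only [b, if_pos hn] at hk
      rcases Nat.lt_succ_iff_lt_or_eq.1 hk with hk | rfl
      · exact hD k hk
      · exact hn.2
    · simp only [b, if_neg hn] at hk
      exact hD k hk
  · intro k hk
    rw [hblk]
    have h1 := hE k hk
    split_ifs with hbk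
    · by_cases hn : new
      · simp only [b, if_pos hn] at hbk
        have := hzero k (by omega)
        -- The fresh block is still empty, and its `back k < s` occupied places leave room for `m`.
        have := hb k
        omega
      · simp only [b, if_neg hn] at hbk
        subst hbk
        have : ¬ #{i ∈ range m | S i ∧ blk i = cur} + back cur = s := fun h => hn ⟨hk, h⟩
        omega
    · exact h1

variable {V : Type*}

open scoped Classical in
/-- The number of indices `i < m` of block `k` whose edge, oriented from `par i` to `ch i`, is
incident to `v`. -/
noncomputable def blockDegree (par ch : ℕ → V) (m : ℕ) (blk : ℕ → ℕ) (v : V) (k : ℕ) : ℕ :=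
  #{i ∈ range m | par i = v ∧ blk i = k} + #{i ∈ range m | ch i = v ∧ blk i = k}

open scoped Classical in
/-- At `v`, every block but the last has at most `s` edges, and exactly `s` edges if a later
block has an edge out of `v`; `inc` marks the beginnings of the blocks of edges out of `v`. -/
structure IsBlockAssignment (par ch : ℕ → V) (m s K : ℕ) (blk : ℕ → ℕ) (inc : ℕ → Prop)
    (v : V) : Prop where
  blk_eq : ∀ i < m, par i = v → blk i = #{j ∈ range (i + 1) | par j = v ∧ inc j}
  blk_lt : ∀ i < m, par i = v → blk i < K
  le : ∀ k, k + 1 < K → blockDegree par ch m blk v k ≤ s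
  eq : ∀ i < m, par i = v → ∀ k < blk i, blockDegree par ch m blk v k = s

lemma IsBlockAssignment.congr {par ch : ℕ → V} {m s K : ℕ} {blk blk' : ℕ → ℕ}
    {inc inc' : ℕ → Prop} {v : V} (h : IsBlockAssignment par ch m s K blk inc v)
    (hblk : ∀ i < m, par i = v ∨ ch i = v → blk' i = blk i)
    (hinc : ∀ i < m, par i = v → (inc' i ↔ inc i)) :
    IsBlockAssignment par ch m s K blk' inc' v := by
  classical
  have hdeg : ∀ k, blockDegree par ch m blk' v k = blockDegree par ch m blk v k := by
    intro k
    refine congrArg₂ (· + ·) (filter_range_congr fun i hi => ?_) (filter_range_congr fun i hi => ?_)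
    · exact and_congr_right fun hv => by rw [hblk i hi (Or.inl hv)]
    · exact and_congr_right fun hv => by rw [hblk i hi (Or.inr hv)]
  refine ⟨fun i hi hv => ?_, fun i hi hv => ?_, fun k hk => ?_, fun i hi hv k hk => ?_⟩
  · rw [hblk i hi (Or.inl hv), h.blk_eq i hi hv]
    exact filter_range_congr fun j hj => and_congr_right fun hv => (hinc j (by omega) hv).symm
  · rw [hblk i hi (Or.inl hv)]
    exact h.blk_lt i hi hv
  · rw [hdeg]
    exact h.le k hk
  · rw [hdeg]
    rw [hblk i hi (Or.inl hv)] at hk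
    exact h.eq i hi hv k hk

open scoped Classical in
-- The block of an edge is chosen at its tail, which has smaller rank than its head. When the
-- vertices of rank `r` are treated, the blocks of the edges entering them are already fixed. These
-- edges are fewer than `s`, so every block has room for an edge going out. Changing the edges out
-- of rank `r` affects no vertex of smaller rank.
lemma exists_isBlockAssignment {par ch : ℕ → V} {m s K : ℕ} (rank : V → ℕ)
    (hrank : ∀ i < m, rank (par i) < rank (ch i)) (hs : ∀ v, #{i ∈ range m | ch i = v} < s)
    (hK : 0 < K) (r : ℕ) :
    ∃ blk inc, ∀ v, rank v < r → IsBlockAssignment par ch m s K blk inc v := by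
  induction r with
  | zero => exact ⟨fun _ => 0, fun _ => True, by simp⟩
  | succ r ih =>
  obtain ⟨blk, inc, h⟩ := ih
  have hback : ∀ v k, #{i ∈ range m | ch i = v ∧ blk i = k} < s := fun v k =>
    (card_le_card (monotone_filter_right _ fun i _ hi => hi.1)).trans_lt (hs v)
  choose nblk ninc hA hB hC hD hE using fun v =>
    exists_blocks (fun i => par i = v) (fun k => #{i ∈ range m | ch i = v ∧ blk i = k})
      (hback v) hK m
  obtain ⟨blk', hblk⟩ : ∃ f : ℕ → ℕ, ∀ i, f i = if rank (par i) = r then nblk (par i) i else blk i :=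
    ⟨_, fun _ => rfl⟩
  obtain ⟨inc', hinc⟩ : ∃ f : ℕ → Prop, ∀ i, f i ↔
      if rank (par i) = r then ninc (par i) i else inc i := ⟨_, fun _ => Iff.rfl⟩
  refine ⟨blk', inc', fun v hv => ?_⟩
  rcases Nat.lt_succ_iff_lt_or_eq.1 hv with hv | hv
  · refine (h v hv).congr ?_ ?_
    · rintro i hi (rfl | rfl)
      · exact (hblk i).trans (if_neg hv.ne)
      · exact (hblk i).trans (if_neg ((hrank i hi).trans hv).ne)
    · rintro i hi rfl
      simp [hinc, hv.ne]
  · have hdeg : ∀ k, blockDegree par ch m blk' v k =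
        #{i ∈ range m | par i = v ∧ nblk v i = k} + #{i ∈ range m | ch i = v ∧ blk i = k} := by
      intro k
      refine congrArg₂ (· + ·) (filter_range_congr fun i hi => and_congr_right ?_)
        (filter_range_congr fun i hi => and_congr_right ?_)
      · rintro rfl
        rw [hblk, if_pos hv]
      · rintro rfl
        rw [hblk, if_neg (hv ▸ (hrank i hi)).ne]
    refine ⟨?_, ?_, ?_, ?_⟩
    · rintro i hi rfl
      rw [hblk, if_pos hv, hA _ i hi rfl]
      refine filter_range_congr fun j hj => and_congr_right fun hj => ?_
      rw [hinc, hj, if_pos hv]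
    · rintro i hi rfl
      rw [hblk, if_pos hv]
      exact (hB _ i hi rfl).trans_lt (hC _)
    · intro k hk
      rw [hdeg]
      exact hE v k hk
    · rintro i hi rfl k hk
      rw [hblk, if_pos hv] at hk
      rw [hdeg]
      exact hD _ k (hk.trans_le (hB _ i hi rfl))

end Blocks

/-! ### Coloring each block with its own palette -/

section BlockColoring

variable {V : Type*}

open scoped Classical in
lemma edgeDegree_image {par ch : ℕ → V} {I : Finset ℕ}
    (hinj : Set.InjOn (fun i => s(par i, ch i)) I) (hne : ∀ i ∈ I, par i ≠ ch i) (v : V) :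
    edgeDegree (I.image fun i => s(par i, ch i)) v =
      #{i ∈ I | par i = v} + #{i ∈ I | ch i = v} := by
  unfold edgeDegree
  rw [filter_image, card_image_of_injOn (hinj.mono (coe_subset.2 (filter_subset _ _))),
    ← card_union_of_disjoint, ← filter_or]
  · exact congrArg card (filter_congr fun i hi => by simp [eq_comm])
  · rw [disjoint_filter]
    rintro i hi rfl h
    exact hne i hi h.symm

open scoped Classical in
lemma sum_blockDegree {par ch : ℕ → V} {m K : ℕ} {blk : ℕ → ℕ} (h : ∀ i < m, blk i < K) (v : V) :
    ∑ k ∈ range K, blockDegree par ch m blk v k =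
      #{i ∈ range m | par i = v} + #{i ∈ range m | ch i = v} := by
  have key : ∀ f : ℕ → V, ∑ k ∈ range K, #{i ∈ range m | f i = v ∧ blk i = k} =
      #{i ∈ range m | f i = v} := by
    intro f
    rw [card_eq_sum_card_fiberwise (f := blk) (t := range K)]
    · exact sum_congr rfl fun k _ => by rw [filter_filter]
    · intro i hi
      simp only [coe_filter, Set.mem_ofPred_eq, mem_range] at hi
      simpa using h i hi.1
  unfold blockDegree
  rw [sum_add_distrib, key, key]

open scoped Classical in
/-- A proper edge coloring with `N` colors, `N` being at least the maximum degree, in which the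
color of an edge is determined, up to an offset below `2 * s`, by the number of earlier marked edges
with the same tail. -/
theorem exists_block_coloring {par ch : ℕ → V} {m d s N : ℕ} {rank : V → ℕ} {r : ℕ}
    (hinj : Set.InjOn (fun i => s(par i, ch i)) (range m))
    (hrank : ∀ i < m, rank (par i) < rank (ch i)) (hr : ∀ v, rank v < r)
    (hdeg : IsDegenerateRank ((range m).image fun i => s(par i, ch i)) rank d)
    (hds : 2 * d ≤ s) (hd : d < s) (hsN : s ≤ N)
    (hN : ∀ v, edgeDegree ((range m).image fun i => s(par i, ch i)) v ≤ N) :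
    ∃ (inc : ℕ → Prop) (off : ℕ → ℕ), (∀ i < m, off i < 2 * s) ∧
      (∀ i < m, s * #{j ∈ range (i + 1) | par j = par i ∧ inc j} + off i < N) ∧
      ∀ i < m, ∀ j < m, i ≠ j → (∃ v, v ∈ s(par i, ch i) ∧ v ∈ s(par j, ch j)) →
        s * #{l ∈ range (i + 1) | par l = par i ∧ inc l} + off i ≠
        s * #{l ∈ range (j + 1) | par l = par j ∧ inc l} + off j := by
  have hne : ∀ i < m, par i ≠ ch i := fun i hi h => (hrank i hi).ne (congrArg rank h)
  have hchd : ∀ v, #{i ∈ range m | ch i = v} ≤ d := by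
    intro v
    rw [← card_image_of_injOn (f := par)]
    · refine hdeg.card_le v _ fun u hu => ?_
      simp only [mem_image, mem_filter, mem_range] at hu
      obtain ⟨i, ⟨hi, rfl⟩, rfl⟩ := hu
      exact ⟨mem_image.2 ⟨i, mem_range.2 hi, Sym2.eq_swap⟩, hrank i hi⟩
    · intro i hi j hj hij
      simp only [coe_filter, Set.mem_ofPred_eq] at hi hj
      refine hinj (mem_coe.2 hi.1) (mem_coe.2 hj.1) ?_
      simp only [hij, hi.2, hj.2]
  have hs : 0 < s := by omega
  set K := N / s
  have hK : 0 < K := Nat.div_pos hsN hs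
  have hK1 : s * K ≤ N := Nat.mul_div_le N s
  have hK2 : N < s * K + s := by
    have := Nat.lt_mul_div_succ N hs
    rwa [mul_add, mul_one] at this
  obtain ⟨blk, inc, hblk⟩ := exists_isBlockAssignment rank hrank
    (fun v => (hchd v).trans_lt hd) hK r
  replace hblk := fun v => hblk v (hr v)
  have hltK : ∀ i < m, blk i < K := fun i hi => (hblk _).blk_lt i hi rfl
  obtain ⟨L, hL⟩ : ∃ L, K = L + 1 := ⟨K - 1, by omega⟩
  have hsL : s * K = s * L + s := by rw [hL, mul_add, mul_one]
  -- Block `L = K - 1` receives all colors from `s * L` on. As `K = N / s`, these are at least `s`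
  -- and fewer than `2 * s`.
  let n : ℕ → ℕ := fun k => if k < L then s else N - s * L
  have hn : ∀ k, s ≤ n k ∧ n k ≤ 2 * s := by
    intro k
    simp only [n]
    split_ifs <;> constructor <;> omega
  let I : ℕ → Finset ℕ := fun k => {i ∈ range m | blk i = k}
  have hIm : ∀ k, I k ⊆ range m := fun k => filter_subset _ _
  have hED : ∀ k v, edgeDegree ((I k).image fun i => s(par i, ch i)) v =
      blockDegree par ch m blk v k := by
    intro k v
    rw [edgeDegree_image (hinj.mono (coe_subset.2 (hIm k)))
      (fun i hi => hne i (mem_range.1 (hIm k hi)))]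
    simp only [I, filter_filter, blockDegree]
    congr 2 <;> exact filter_congr fun i _ => and_comm
  have hbd : ∀ k v, blockDegree par ch m blk v k ≤ n k := by
    intro k v
    by_cases hk : k < L
    · simp only [n, if_pos hk]
      exact (hblk v).le k (by omega)
    -- In the last block, a vertex with an outgoing edge has exactly `s` edges in each earlier
    -- block, so at most `N - s * L` of its edges remain. A vertex without one has only entering
    -- edges there, at most `d`.
    by_cases hex : ∃ i < m, par i = v ∧ blk i = k
    · obtain ⟨i, hi, hiv, rfl⟩ := hex
      have hiL : blk i = L := by have := hltK i hi; omega
      have h1 := sum_blockDegree (par := par) (ch := ch) hltK v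
      have h2 := hN v
      rw [edgeDegree_image hinj (fun i hi => hne i (mem_range.1 hi)), ← h1, hL, sum_range_succ,
        sum_congr rfl fun k hk => (hblk v).eq i hi hiv k (hiL ▸ mem_range.1 hk), sum_const,
        card_range, smul_eq_mul, mul_comm] at h2
      simp only [n, if_neg hk]
      rw [hiL]
      omega
    · refine le_trans ?_ (hn k).1
      unfold blockDegree
      rw [filter_eq_empty_iff.2 (fun i hi h => hex ⟨i, mem_range.1 hi, h⟩), card_empty, zero_add]
      exact (card_le_card (monotone_filter_right _ fun i _ hi => hi.1)).trans
        ((hchd v).trans hd.le)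
  choose c hc hcn using fun k => IsDegenerateRank.exists_isProperOn (n := n k)
    (hds.trans (hn k).1) _ (hdeg.mono (image_subset_image (hIm k)))
    (fun v => (hED k v).trans_le (hbd k v))
  have hmem : ∀ i < m, s(par i, ch i) ∈ (I (blk i)).image fun i => s(par i, ch i) := fun i hi =>
    mem_image_of_mem _ (by simp [I, hi])
  have hoff : ∀ i < m, c (blk i) s(par i, ch i) < n (blk i) := fun i hi =>
    hcn _ _ (hmem i hi)
  have hoffs : ∀ i < m, blk i < L → c (blk i) s(par i, ch i) < s := fun i hi hiL => by
    have := hoff i hi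
    simpa only [n, if_pos hiL] using this
  refine ⟨inc, fun i => c (blk i) s(par i, ch i), fun i hi => (hoff i hi).trans_le (hn _).2, ?_, ?_⟩
  · intro i hi
    rw [← (hblk (par i)).blk_eq i hi rfl]
    beta_reduce
    by_cases hiL : blk i < L
    · have h1 := hoffs i hi hiL
      have h2 : s * (blk i + 1) ≤ s * L := Nat.mul_le_mul_left s hiL
      rw [mul_add, mul_one] at h2
      omega
    · have h1 := hoff i hi
      simp only [n, if_neg hiL] at h1
      have h2 : blk i = L := by have := hltK i hi; omega
      rw [h2] at h1 ⊢
      omega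
  · have hlt : ∀ i < m, ∀ j < m, blk i < blk j →
        s * blk i + c (blk i) s(par i, ch i) < s * blk j + c (blk j) s(par j, ch j) := by
      intro i hi j hj hij
      have h1 := hoffs i hi (by have := hltK j hj; omega)
      have h2 : s * (blk i + 1) ≤ s * blk j := Nat.mul_le_mul_left s hij
      rw [mul_add, mul_one] at h2
      omega
    intro i hi j hj hij ⟨v, hvi, hvj⟩
    rw [← (hblk (par i)).blk_eq i hi rfl, ← (hblk (par j)).blk_eq j hj rfl]
    rcases lt_trichotomy (blk i) (blk j) with h | h | h
    · exact (hlt i hi j hj h).ne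
    · have h1 := hc (blk i) _ (hmem i hi) _ (h ▸ hmem j hj)
        (fun h => hij (hinj (by simpa using hi) (by simpa using hj) h)) v hvi hvj
      beta_reduce at h1 ⊢
      rw [← h]
      exact fun h2 => h1 (Nat.add_left_cancel h2)
    · exact (hlt j hj i hi h).ne'

end BlockColoring

/-! ### From the input sequence to optimal advice -/

section Input

universe u

variable {V : Type u}

open scoped Classical in
lemma EdgeSeq.mem_edgeSet_graph (σ : EdgeSeq V) (e : Sym2 V) :
    e ∈ σ.graph.edgeSet ↔ e ∈ σ.edges.toFinset := by
  simp only [graph, SimpleGraph.edgeSet_fromEdgeSet, Set.mem_sdiff, Set.mem_ofPred_eq,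
    List.mem_toFinset, Sym2.mem_diagSet]
  exact ⟨fun h => h.1, fun h => ⟨h, σ.loopless e h⟩⟩

lemma EdgeSeq.finite_support_graph (σ : EdgeSeq V) : σ.graph.support.Finite := by
  classical
  have h : σ.graph.support ⊆ ⋃ e ∈ σ.edges.toFinset, {v | v ∈ e} := by
    rintro v ⟨w, hw⟩
    simp only [Set.mem_iUnion]
    exact ⟨s(v, w), (σ.mem_edgeSet_graph _).1 hw, by simp⟩
  refine Set.Finite.subset (Set.Finite.biUnion (finite_toSet _) fun e _ => ?_) h
  induction e with
  | _ p q => exact (Set.toFinite {p, q}).subset fun v hv => by simpa using hv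

lemma EdgeSeq.isDegenerate_degeneracy (σ : EdgeSeq V) :
    IsDegenerate σ.graph (degeneracy σ.graph) := by
  classical
  refine Nat.sInf_mem (s := {d | IsDegenerate σ.graph d}) ?_
  refine ⟨_, σ.finite_support_graph.toFinset.toList, nodup_toList _, by simp,
    fun i _ => (Set.ncard_le_ncard (t := σ.graph.support) ?_ σ.finite_support_graph)⟩
  rintro u ⟨-, hu⟩
  exact ⟨_, hu.symm⟩

open scoped Classical in
lemma EdgeSeq.exists_isDegenerateRank (σ : EdgeSeq V) {d : ℕ} (h : IsDegenerate σ.graph d) :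
    ∃ (rank : V → ℕ) (r : ℕ), (∀ v, rank v < r) ∧
      IsDegenerateRank σ.edges.toFinset rank d := by
  obtain ⟨vs, hnd, hmem, hd⟩ := h
  -- Names outside the ordering all get rank `vs.length`, hence the bound `vs.length + 1`. They are
  -- on no edge, so sharing a rank does no harm.
  refine ⟨fun v => vs.idxOf v, vs.length + 1, fun v => Nat.lt_succ_of_le List.idxOf_le_length,
    fun u v huv h => ?_, fun v t ht => ?_⟩
  · have hadj : σ.graph.Adj u v := (σ.mem_edgeSet_graph _).2 huv
    exact hadj.ne ((List.idxOf_inj ((hmem u).2 ⟨v, hadj⟩)).1 h)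
  · have hadj : ∀ u ∈ t, σ.graph.Adj v u := fun u hu => (σ.mem_edgeSet_graph _).2 (ht u hu).1
    rcases t.eq_empty_or_nonempty with rfl | ⟨w, hw⟩
    · simp
    have hv : vs.idxOf v < vs.length := List.idxOf_lt_length_iff.2 ((hmem v).2 ⟨w, hadj w hw⟩)
    refine le_trans ?_ (hd _ hv)
    rw [← Set.ncard_coe_finset]
    refine Set.ncard_le_ncard (fun u hu => ?_)
      (σ.finite_support_graph.subset fun u hu => ⟨_, hu.2.symm⟩)
    have hu' : u ∈ vs := (hmem u).2 ⟨v, (hadj u hu).symm⟩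
    refine ⟨?_, ?_⟩
    · rw [List.mem_take_iff_getElem]
      exact ⟨vs.idxOf u, lt_min (ht u hu).2 (List.idxOf_lt_length_iff.2 hu'), by simp⟩
    · simpa using hadj u hu

open scoped Classical in
-- The edges at `v` form a clique of the line graph.
lemma EdgeSeq.edgeDegree_le_chromaticIndex (σ : EdgeSeq V) (v : V) :
    (edgeDegree σ.edges.toFinset v : ℕ∞) ≤ chromaticIndex σ.graph := by
  set S := ({e ∈ σ.edges.toFinset | v ∈ e} : Finset (Sym2 V))
  have hS : ∀ e : {e // e ∈ S}, e.1 ∈ σ.graph.edgeSet ∧ v ∈ e.1 := by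
    rintro ⟨e, he⟩
    exact ⟨(σ.mem_edgeSet_graph e).2 (mem_filter.1 he).1, (mem_filter.1 he).2⟩
  refine SimpleGraph.le_chromaticNumber_of_pairwise_adj (ι := {e // e ∈ S}) ?_
    (fun e => ⟨e.1, (hS e).1⟩) ?_
  · rw [Nat.card_eq_fintype_card, Fintype.card_coe]
    exact le_of_eq (by simp only [edgeDegree, S])
  · intro e f hef
    rw [SimpleGraph.lineGraph_adj_iff_exists]
    exact ⟨fun h => hef (Subtype.ext (congrArg (fun g => g.1) h)), v, (hS e).2, (hS f).2⟩

open scoped Classical in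
-- Any coloring with `n` colors bounds the chromatic index by `n`, so the colors of an optimal one
-- still fit into an offset below `n`. The shift by one arises because colors here start at 0.
lemma EdgeSeq.exists_optimal (σ : EdgeSeq V) {c : Sym2 V → ℕ} {n : ℕ}
    (hc : IsProperOn σ.edges.toFinset c) (hn : ∀ e ∈ σ.edges.toFinset, c e < n) :
    ∃ c : Sym2 V → ℕ, IsProperOn σ.edges.toFinset c ∧ ∀ e ∈ σ.edges.toFinset,
      c e < n ∧ ((c e + 1 : ℕ) : ℕ∞) ≤ chromaticIndex σ.graph := by
  have hcol : σ.graph.lineGraph.Colorable n := by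
    refine ⟨SimpleGraph.Coloring.mk
      (fun e => ⟨c e.1, hn _ ((σ.mem_edgeSet_graph _).1 e.2)⟩) ?_⟩
    intro e f hef
    rw [SimpleGraph.lineGraph_adj_iff_exists] at hef
    obtain ⟨hne, v, hve, hvf⟩ := hef
    intro h
    exact hc _ ((σ.mem_edgeSet_graph _).1 e.2) _ ((σ.mem_edgeSet_graph _).1 f.2)
      (fun h => hne (Subtype.ext h)) v hve hvf (Fin.mk.inj h)
  have hle := hcol.chromaticNumber_le
  obtain ⟨k, hk⟩ := ENat.ne_top_iff_exists.1 (ne_top_of_le_ne_top (ENat.natCast_ne_top n) hle)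
  rw [← hk, Nat.cast_le] at hle
  obtain ⟨g⟩ := SimpleGraph.chromaticNumber_le_iff_colorable.1 hk.ge
  have hcol : ∀ e, ∃ a, ∀ h : e ∈ σ.graph.edgeSet, a = (g ⟨e, h⟩ : ℕ) := by
    intro e
    by_cases h : e ∈ σ.graph.edgeSet
    · exact ⟨g ⟨e, h⟩, fun _ => rfl⟩
    · exact ⟨0, fun h' => absurd h' h⟩
  choose c' hc' using hcol
  refine ⟨c', ?_, ?_⟩
  · intro e he f hf hef v hve hvf
    have he' := (σ.mem_edgeSet_graph _).2 he
    have hf' := (σ.mem_edgeSet_graph _).2 hf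
    rw [hc' e he', hc' f hf']
    refine fun h => g.valid (v := ⟨e, he'⟩) (w := ⟨f, hf'⟩) ?_ (Fin.ext h)
    rw [SimpleGraph.lineGraph_adj_iff_exists]
    exact ⟨fun h => hef (congrArg Subtype.val h), v, hve, hvf⟩
  · intro e he
    have he' := (σ.mem_edgeSet_graph _).2 he
    have := (g ⟨e, he'⟩).2
    rw [hc' e he', chromaticIndex, ← hk, Nat.cast_le]
    omega

open scoped Classical in
/-- Advice for an optimal coloring: for every edge an endpoint `par`, a mark `inc` and an offset
below `2 * s`. -/
theorem EdgeSeq.exists_advice (σ : EdgeSeq V) [Nonempty V] {d s : ℕ}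
    (h : IsDegenerate σ.graph d) (hds : 2 * d ≤ s) (hd : d < s) :
    ∃ (par : ℕ → V) (inc : ℕ → Prop) (off : ℕ → ℕ),
      (∀ (i : ℕ) (hi : i < σ.edges.length), par i ∈ σ.edges[i] ∧ off i < 2 * s) ∧
      IsOptimalColoring σ
        fun i => s * #{j ∈ range (i + 1) | par j = par i ∧ inc j} + off i + 1 := by
  obtain ⟨rank, r, hr, hdeg⟩ := σ.exists_isDegenerateRank h
  have hpc : ∀ i, ∃ p : V × V, ∀ hi : i < σ.edges.length,
      σ.edges[i] = s(p.1, p.2) ∧ rank p.1 < rank p.2 := by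
    intro i
    by_cases hi : i < σ.edges.length
    · have hmem : σ.edges[i] ∈ σ.edges.toFinset := by simp
      obtain ⟨⟨u, v⟩, huv⟩ := Sym2.mk_surjective σ.edges[i]
      rw [← huv] at hmem
      rcases lt_or_gt_of_ne (hdeg.ne u v hmem) with h | h
      · exact ⟨(u, v), fun _ => ⟨huv.symm, h⟩⟩
      · exact ⟨(v, u), fun _ => ⟨huv.symm.trans Sym2.eq_swap, h⟩⟩
    · exact ⟨(Classical.arbitrary V, Classical.arbitrary V), fun h => absurd h hi⟩
  choose p hp using hpc
  set par : ℕ → V := fun i => (p i).1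
  set ch : ℕ → V := fun i => (p i).2
  have hedge : ∀ (i : ℕ) (hi : i < σ.edges.length), σ.edges[i] = s(par i, ch i) :=
    fun i hi => (hp i hi).1
  have hE : (range σ.edges.length).image (fun i => s(par i, ch i)) = σ.edges.toFinset := by
    ext e
    simp only [mem_image, mem_range, List.mem_toFinset, List.mem_iff_getElem]
    constructor
    · rintro ⟨i, hi, rfl⟩
      exact ⟨i, hi, hedge i hi⟩
    · rintro ⟨i, hi, rfl⟩
      exact ⟨i, hi, (hedge i hi).symm⟩
  have hinj : Set.InjOn (fun i => s(par i, ch i)) (range σ.edges.length) := by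
    intro i hi j hj hij
    rw [mem_coe, mem_range] at hi hj
    beta_reduce at hij
    rw [← hedge i hi, ← hedge j hj] at hij
    exact (σ.nodup.getElem_inj_iff).1 hij
  have hpar : ∀ (i : ℕ) (hi : i < σ.edges.length), par i ∈ σ.edges[i] := fun i hi => by
    rw [hedge i hi]
    simp
  -- With degrees at most `2 * s`, no marks are needed. This case includes all graphs whose
  -- chromatic index exceeds the maximum degree. In the other case the maximum degree `N` is itself
  -- a sufficient number of colors, and it never exceeds the chromatic index.
  by_cases hsmall : ∀ v, edgeDegree σ.edges.toFinset v ≤ 2 * s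
  · obtain ⟨c, hc, hcn⟩ := hdeg.exists_isProperOn (n := 2 * s) (by omega) _ hsmall
    obtain ⟨c, hc, hcn⟩ := σ.exists_optimal hc hcn
    have hmem : ∀ i < σ.edges.length, s(par i, ch i) ∈ σ.edges.toFinset := fun i hi => by
      rw [← hedge i hi]
      simp
    refine ⟨par, fun _ => False, fun i => c s(par i, ch i), fun i hi => ⟨hpar i hi, ?_⟩, ?_, ?_⟩
    · exact (hcn _ (hmem i hi)).1
    · intro i hi
      simpa using (hcn _ (hmem i hi)).2
    · intro i j hi hj hij ⟨v, hvi, hvj⟩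
      rw [hedge i hi] at hvi
      rw [hedge j hj] at hvj
      have := hc _ (hmem i hi) _ (hmem j hj)
        (fun h => hij (hinj (by simpa using hi) (by simpa using hj) h)) v hvi hvj
      simpa using this
  · push Not at hsmall
    obtain ⟨v₀, hv₀⟩ := hsmall
    obtain ⟨N, ⟨v, hv⟩, hmax⟩ : ∃ N, (∃ v, edgeDegree σ.edges.toFinset v = N) ∧
        ∀ v, edgeDegree σ.edges.toFinset v ≤ N := by
      have hfin : (Set.range (edgeDegree σ.edges.toFinset)).Finite :=
        (Set.finite_Iic #σ.edges.toFinset).subset (by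
          rintro _ ⟨v, rfl⟩
          exact card_le_card (filter_subset _ _))
      obtain ⟨N, ⟨v, hv⟩, hmax⟩ := Set.exists_max_image _ id hfin ⟨_, v₀, rfl⟩
      exact ⟨N, ⟨v, hv⟩, fun w => hmax _ ⟨w, rfl⟩⟩
    have hsN : s ≤ N := by
      have := hmax v₀
      omega
    obtain ⟨inc, off, hoff, hle, hne⟩ := exists_block_coloring hinj (fun i hi => (hp i hi).2) hr
      (hE ▸ hdeg) hds hd hsN (hE ▸ hmax)
    refine ⟨par, inc, off, fun i hi => ⟨hpar i hi, hoff i hi⟩, fun i hi => ⟨Nat.le_add_left _ _, ?_⟩, ?_⟩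
    · refine le_trans ?_ (σ.edgeDegree_le_chromaticIndex v)
      rw [hv, Nat.cast_le]
      exact hle i hi
    · intro i j hi hj hij hv
      rw [hedge i hi, hedge j hj] at hv
      have := hne i hi j hj hij hv
      beta_reduce
      omega

/-- This makes log₂(d+1) at least 1, which absorbs the additive constants in the number of bits. -/
lemma EdgeSeq.degeneracy_pos (σ : EdgeSeq V) (h : 0 < σ.size) : 0 < degeneracy σ.graph := by
  classical
  obtain ⟨rank, r, -, hdeg⟩ := σ.exists_isDegenerateRank σ.isDegenerate_degeneracy
  have hmem : σ.edges[0]'h ∈ σ.edges.toFinset := List.mem_toFinset.2 (List.getElem_mem h)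
  revert hmem
  generalize σ.edges[0]'h = e
  induction e with
  | _ u v =>
    intro hmem
    rcases lt_or_gt_of_ne (hdeg.ne u v hmem) with h | h
    · exact hdeg.card_le v {u} (by simpa [h, Sym2.eq_swap] using hmem)
    · exact hdeg.card_le u {v} (by simpa [h] using hmem)

end Input

/-! ### Encoding the advice: the request model -/

section Algorithms

universe u

variable {V : Type u}

lemma IsOptimalColoring.congr {σ : EdgeSeq V} {c c' : ℕ → ℕ} (h : IsOptimalColoring σ c)
    (hc : ∀ i < σ.size, c' i = c i) : IsOptimalColoring σ c' := by
  refine ⟨fun i hi => hc i hi ▸ h.1 i hi, fun i j hi hj hij hv => ?_⟩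
  rw [hc i hi, hc j hj]
  exact h.2 i j hi hj hij hv

/-- The number with the given binary digits, least significant first. -/
def ofBits : List Bool → ℕ
  | [] => 0
  | b :: l => b.toNat + 2 * ofBits l

lemma exists_ofBits_eq (n x : ℕ) (hx : x < 2 ^ n) : ∃ l, l.length = n ∧ ofBits l = x := by
  induction n generalizing x with
  | zero => exact ⟨[], rfl, by simp [ofBits]; omega⟩
  | succ n ih =>
    obtain ⟨l, hl, hlx⟩ := ih (x / 2) (by rw [pow_succ] at hx; omega)
    refine ⟨decide (x % 2 = 1) :: l, by simp [hl], ?_⟩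
    rw [ofBits, hlx]
    rcases Nat.mod_two_eq_zero_or_one x with h | h <;> simp [h] <;> omega

/-- The endpoint of `e` selected by the first bit of the advice string `l`. -/
noncomputable def adviceTail (e : Sym2 V) (l : List Bool) : V :=
  if l.head? = some true then (Quot.out e).1 else (Quot.out e).2

/-- Oracle and algorithm share the order of endpoints fixed by `Quot.out`, so one bit names an
endpoint. -/
lemma exists_adviceTail_eq {e : Sym2 V} {v : V} (hv : v ∈ e) :
    ∃ b : Bool, ∀ l, adviceTail e (b :: l) = v := by
  rw [← Quot.out_eq e] at hv
  rcases Sym2.mem_iff.1 hv with h | h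
  · exact ⟨true, fun l => h.symm⟩
  · exact ⟨false, fun l => h.symm⟩

open scoped Classical in
/-- The algorithm for the advice-with-request model: the first bit of an advice string selects
the tail of the edge, the second one tells if the tail begins a new block of `2 ^ (b - 3)` colors,
`b` being the length of the string, and the others give the offset within the block. -/
noncomputable def requestAlg : RequestAlg V := fun es bs =>
  let str : ℕ → List Bool := fun j => bs[j]?.getD []
  let tail : ℕ → Option V := fun j => es[j]?.map fun e => adviceTail e (str j)
  let i := es.length - 1
  2 ^ ((str i).length - 3) *
    #{j ∈ range (i + 1) | tail j = tail i ∧ (str j)[1]? = some true} + ofBits ((str i).drop 2) + 1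

/-- With `a = Nat.log 2 d` and `s = 2 ^ (a + 2)` one has `2 * d < s`. An offset below `2 * s` takes
`a + 3` bits, and the tail and the mark one bit each. The string length `a + 5` reveals `s`, so `d`
need not be known. -/
theorem exists_requestAdvice (σ : EdgeSeq V) :
    ∃ B, IsRequestAdvice σ (Nat.log 2 (degeneracy σ.graph) + 5) B ∧
      IsOptimalColoring σ (requestAlg.color σ B) := by
  classical
  rcases Nat.eq_zero_or_pos σ.size with h0 | hpos
  · refine ⟨[], ⟨by simp [h0], by simp⟩, fun i hi => by omega, fun i j hi => ?_⟩
    exact absurd hi (by rw [EdgeSeq.size] at h0; omega)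
  set a := Nat.log 2 (degeneracy σ.graph)
  have hd : degeneracy σ.graph < 2 ^ (a + 1) := Nat.lt_pow_succ_log_self (by norm_num) _
  have hs : 2 ^ (a + 2) = 2 * 2 ^ (a + 1) := pow_succ' 2 (a + 1)
  have : Nonempty V := ⟨(Quot.out (σ.edges[0]'hpos)).1⟩
  obtain ⟨par, inc, off, hpo, hopt⟩ := σ.exists_advice σ.isDegenerate_degeneracy
    (s := 2 ^ (a + 2)) (by omega) (by omega)
  have hstr : ∀ i, ∃ l : List Bool, l.length = a + 5 ∧ ∀ hi : i < σ.edges.length,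
      adviceTail σ.edges[i] l = par i ∧ (l[1]? = some true ↔ inc i) ∧
        ofBits (l.drop 2) = off i := by
    intro i
    by_cases hi : i < σ.edges.length
    · obtain ⟨b, hb⟩ := exists_adviceTail_eq (hpo i hi).1
      obtain ⟨l, hl, hlo⟩ := exists_ofBits_eq (a + 3) (off i) (by
        rw [pow_succ']
        exact (hpo i hi).2)
      exact ⟨b :: decide (inc i) :: l, by simp [hl], fun _ => ⟨hb _, by simp, by simpa using hlo⟩⟩
    · exact ⟨List.replicate (a + 5) true, by simp, fun h => absurd h hi⟩
  choose str hlen hstr using hstr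
  set B := (List.range σ.size).map str
  have hB : ∀ j < σ.size, B[j]? = some (str j) := fun j hj => by simp [B, hj]
  refine ⟨B, ⟨by simp [B], by simp [B, hlen]⟩, hopt.congr fun i hi => ?_⟩
  have hstrj : ∀ j ≤ i, (B.take (i + 1))[j]?.getD [] = str j := fun j hj => by
    rw [List.getElem?_take_of_lt (by omega), hB j (by omega), Option.getD_some]
  have htail : ∀ j ≤ i, (σ.edges.take (i + 1))[j]?.map
      (fun e => adviceTail e ((B.take (i + 1))[j]?.getD [])) = some (par j) := fun j hj => by
    have hj' : j < σ.edges.length := lt_of_le_of_lt hj hi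
    rw [hstrj j hj, List.getElem?_take_of_lt (by omega), List.getElem?_eq_getElem hj',
      Option.map_some, (hstr j hj').1]
  have hi' : (σ.edges.take (i + 1)).length - 1 = i := by
    rw [List.length_take, min_eq_left (show i + 1 ≤ σ.edges.length from hi), Nat.add_sub_cancel]
  simp only [RequestAlg.color, requestAlg]
  rw [hi', htail i le_rfl, hstrj i le_rfl, hlen, (hstr i hi).2.2]
  congr 3
  refine filter_range_congr fun j hj => ?_
  rw [htail j (by omega), hstrj j (by omega), Option.some_inj,
    (hstr j (lt_of_lt_of_le hj hi)).2.1]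

/-! ### The tape model -/

lemma take_drop_flatten {B : List (List Bool)} {b : ℕ} (h : ∀ s ∈ B, s.length = b) (j : ℕ)
    (hj : j < B.length) : (B.flatten.drop (j * b)).take b = B[j] := by
  induction B generalizing j with
  | nil => simp at hj
  | cons s B ih =>
    have hs : s.length = b := h s (by simp)
    cases j with
    | zero => simp [← hs]
    | succ j =>
      have h1 : (j + 1) * b = s.length + j * b := by rw [hs]; ring
      rw [List.flatten_cons, h1, ← List.drop_drop, List.drop_left]
      simpa using ih (fun s hs => h s (by simp [hs])) j (by simpa using hj)

/-- The algorithm for the advice-on-tape model that runs `A`: the tape begins with the number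
`b` of bits per edge in unary, followed by the advice strings of length `b`. -/
def tapeAlg (A : RequestAlg V) : TapeAlg V := fun es bits =>
  let b := bits.idxOf false
  if bits.length < b + 1 + es.length * b then none
  else some (A es ((List.range es.length).map fun j => (bits.drop (b + 1 + j * b)).take b))

/-- The unary header is self-delimiting and costs `b + 1` bits once. Since it is read only when an
edge arrives, it can be charged to the edges, giving at most `2 * b + 1` bits per edge. -/
theorem exists_isRun_tapeAlg (A : RequestAlg V) (σ : EdgeSeq V) {b : ℕ} {B : List (List Bool)}
    (hB : IsRequestAdvice σ b B) :
    ∃ (tape : ℕ → Bool) (r : ℕ → ℕ), (tapeAlg A).IsRun σ tape r (A.color σ B) ∧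
      r σ.size ≤ σ.size * (2 * b + 1) := by
  obtain ⟨hlen, hb⟩ := hB
  set L := List.replicate b true ++ false :: B.flatten
  have hflat : B.flatten.length = σ.size * b := by
    rw [List.length_flatten, List.map_congr_left hb, List.map_const', List.sum_replicate,
      smul_eq_mul, hlen]
  have hL : L.length = b + 1 + σ.size * b := by
    simp only [L, List.length_append, List.length_replicate, List.length_cons, hflat]
    omega
  set tape : ℕ → Bool := fun n => L[n]?.getD false
  have hpre : ∀ q ≤ L.length, tapePrefix tape q = L.take q := by
    intro q hq
    refine List.ext_getElem (by simp [tapePrefix, hq]) fun n h1 h2 => ?_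
    have hn : n < L.length := by simp at h2; omega
    simp [tapePrefix, tape, List.getElem?_eq_getElem hn]
  have hidx : ∀ q, b < q → (L.take q).idxOf false = b := by
    intro q hq
    obtain ⟨t, rfl⟩ : ∃ t, q = b + (t + 1) := ⟨q - b - 1, by omega⟩
    have : L.take (b + (t + 1)) = List.replicate b true ++ false :: B.flatten.take t := by
      simp [L, List.take_append]
    rw [this, List.idxOf_append_of_notMem (by simp), List.idxOf_cons_self]
    simp
  -- Until the delimiter `false` has been read, `idxOf` returns the number of bits read so far. The
  -- test then always asks for more bits than that, so the algorithm keeps reading.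
  have hidx' : ∀ q ≤ b, (L.take q).idxOf false = q := by
    intro q hq
    have : L.take q = List.replicate q true := by
      simp [L, List.take_append, hq]
    rw [this, List.idxOf_of_notMem (by simp), List.length_replicate]
  have hes : ∀ i < σ.size, (σ.edges.take (i + 1)).length = i + 1 := fun i hi => by
    rw [List.length_take, min_eq_left (show i + 1 ≤ σ.edges.length from hi)]
  let r : ℕ → ℕ := fun i => if i = 0 then 0 else b + 1 + i * b
  have hr : ∀ i, r (i + 1) = b + 1 + (i + 1) * b := fun i => if_neg (Nat.succ_ne_zero i)
  refine ⟨tape, r, ⟨rfl, fun i hi => ⟨?_, fun q hq1 hq2 => ?_, ?_⟩⟩, ?_⟩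
  · rw [hr]
    simp only [r]
    split_ifs
    · exact Nat.zero_le _
    · gcongr
      omega
  · have hle : (i + 1) * b ≤ σ.size * b := Nat.mul_le_mul_right b hi
    rw [hr] at hq2
    have hqL : q ≤ L.length := by omega
    rw [hpre q hqL, tapeAlg]
    refine if_pos ?_
    rw [hes i hi, List.length_take, min_eq_left hqL]
    rcases le_or_gt q b with h | h
    · rw [hidx' q h]
      omega
    · rwa [hidx q h]
  · have hle : (i + 1) * b ≤ σ.size * b := Nat.mul_le_mul_right b hi
    rw [hr, hpre _ (by omega), tapeAlg]
    have hid := hidx (b + 1 + (i + 1) * b) (by omega)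
    rw [hid, if_neg (by rw [hes i hi, List.length_take, min_eq_left (by omega)]; omega),
      RequestAlg.color, hes i hi]
    congr 2
    refine List.ext_getElem (by simp [hlen]; exact hi) fun j h1 h2 => ?_
    have hj : j < i + 1 := by simpa using h1
    have hjb : (j + 1) * b ≤ (i + 1) * b := Nat.mul_le_mul_right b hj
    rw [add_mul, one_mul] at hjb
    have hjB : j < B.length := by omega
    simp only [List.getElem_map, List.getElem_range, List.getElem_take]
    rw [← take_drop_flatten hb j hjB, List.drop_take, List.take_take, min_eq_left (by omega)]
    congr 1
    have : L = (List.replicate b true ++ [false]) ++ B.flatten := by simp [L]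
    rw [this, ← List.drop_drop, List.drop_left' (by simp)]
  · simp only [r]
    split_ifs with h
    · exact Nat.zero_le _
    · have : b + 1 ≤ σ.size * (b + 1) := Nat.le_mul_of_pos_left _ (Nat.pos_of_ne_zero h)
      calc b + 1 + σ.size * b ≤ σ.size * (b + 1) + σ.size * b := by gcongr
        _ = _ := by ring

lemma adviceLength_le {d : ℕ} (hd : 0 < d) :
    ((Nat.log 2 d + 5 : ℕ) : ℝ) ≤ 6 * Real.logb 2 (d + 1) := by
  have h1 : (Nat.log 2 d : ℝ) ≤ Real.logb 2 d := Real.natLog_le_logb d 2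
  have hd' : (1 : ℝ) ≤ d := by exact_mod_cast hd
  have h2 : Real.logb 2 d ≤ Real.logb 2 (d + 1) :=
    Real.logb_le_logb_of_le (by norm_num) (by linarith) (by linarith)
  have h3 : 1 ≤ Real.logb 2 (d + 1) := by
    rw [Real.le_logb_iff_rpow_le (by norm_num) (by linarith), Real.rpow_one]
    linarith
  push_cast
  linarith

end Algorithms
end OnlineEdgeColoring

theorem theorem3 :
    ∃ C : ℝ, ∀ V : Type*,
      -- advice-with-request: `b d` bits per edge for inputs of degeneracy `d`
      (∃ (A : OnlineEdgeColoring.RequestAlg V) (b : ℕ → ℕ)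
          (oracle : OnlineEdgeColoring.EdgeSeq V → List (List Bool)),
        ∀ σ : OnlineEdgeColoring.EdgeSeq V,
          OnlineEdgeColoring.IsRequestAdvice σ
            (b (OnlineEdgeColoring.degeneracy σ.graph)) (oracle σ) ∧
          OnlineEdgeColoring.IsOptimalColoring σ (A.color σ (oracle σ)) ∧
          ((σ.size * b (OnlineEdgeColoring.degeneracy σ.graph) : ℕ) : ℝ) ≤
            C * σ.size * Real.logb 2 (OnlineEdgeColoring.degeneracy σ.graph + 1)) ∧
      -- advice-on-tape
      (∃ (A : OnlineEdgeColoring.TapeAlg V)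
          (oracle : OnlineEdgeColoring.EdgeSeq V → ℕ → Bool),
        ∀ σ : OnlineEdgeColoring.EdgeSeq V, ∃ r c : ℕ → ℕ,
          A.IsRun σ (oracle σ) r c ∧
          OnlineEdgeColoring.IsOptimalColoring σ c ∧
          (r σ.size : ℝ) ≤
            C * σ.size * Real.logb 2 (OnlineEdgeColoring.degeneracy σ.graph + 1)) := by
  open OnlineEdgeColoring in
  have hbound : ∀ {V : Type _} (σ : EdgeSeq V),
      (σ.size * (2 * (Nat.log 2 (degeneracy σ.graph) + 5) + 1 : ℕ) : ℝ) ≤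
        13 * σ.size * Real.logb 2 (degeneracy σ.graph + 1) := by
    intro V σ
    rcases Nat.eq_zero_or_pos σ.size with h0 | hpos
    · simp [h0]
    have hd := σ.degeneracy_pos hpos
    have h1 := adviceLength_le hd
    have h2 : (1 : ℝ) ≤ Real.logb 2 (degeneracy σ.graph + 1) := by
      have : (1 : ℝ) ≤ degeneracy σ.graph := by exact_mod_cast hd
      rw [Real.le_logb_iff_rpow_le (by norm_num) (by linarith), Real.rpow_one]
      linarith
    rw [mul_comm (13 : ℝ), mul_assoc]
    gcongr
    push_cast at h1 ⊢
    linarith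
  -- With ℓ = log₂(d+1) ≥ 1, the string length is at most 6ℓ, so the tape model uses at most 2 · 6ℓ
  -- + 1 ≤ 13ℓ bits per edge. The request model needs fewer.
  refine ⟨13, fun V => ?_⟩
  choose B hB hopt using OnlineEdgeColoring.exists_requestAdvice (V := V)
  refine ⟨⟨_, fun d => Nat.log 2 d + 5, B, fun σ => ⟨hB σ, hopt σ, ?_⟩⟩, ?_⟩
  · refine le_trans ?_ (hbound σ)
    rw [Nat.cast_mul]
    gcongr
    beta_reduce
    omega
  · choose tape r hrun hr using fun σ =>
      OnlineEdgeColoring.exists_isRun_tapeAlg OnlineEdgeColoring.requestAlg σ (hB σ)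
    refine ⟨_, tape, fun σ => ⟨r σ, _, hrun σ, hopt σ, le_trans ?_ (hbound σ)⟩⟩
    exact_mod_cast hr σ
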